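/- For a number field $K$ of degree $n$ with ring of integers $\mathcal{O}_K$, say that Heilbronn's criterion applies to $K$ if there is a prime $\ell$ that is totally ramified in $K$ (that is, $(\ell)=\mathfrak{l}^n$ for a prime ideal $\mathfrak{l}$ of $\mathcal{O}_K$) and that can be written as $\ell=a+b$ with positive integers $a,b$ such that neither $a$ nor $-b$ is the norm of an element of $\mathcal{O}_K$, and $a\equiv x^n \pmod{\ell}$ for some integer $x$. Say that the criterion applies to an irreducible polynomial $f\in\mathbb{Z}[x]$ if it applies to $\mathbb{Q}[x]/(f)$. For a prime $p$ and an integer $n\geq 1$, let $\mathcal{F}_{p,n}$ be the set of monic polynomials $f\in\mathbb{Z}[x]$ of degree $n$ that are Eisenstein at $p$. For $f(x)=a_nx^n+\dots+a_0$ put $\mathrm{Ht}(f)=\max_i|a_i|$, and let $\delta_{p,n}(X)$ be the proportion, among the $f\in\mathcal{F}_{p,n}$ with $\mathrm{Ht}(f)\leq X$, of those to which Heilbronn's criterion applies. **Theorem 2.** There is an effectively computable function $\hat\varepsilon$ (a computable sequence of real numbers $\hat\varepsilon(p)$, independent of $n$), with $\hat\varepsilon(p)\to 0$ as $p\to\infty$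 effectively (with a computable modulus of convergence), such that for every integer $n\geq 2$ and every prime $p\geq 5$ with $$\gcd(p-1,n)<\frac{p^{1/2}}{(\log p)^2}$$ one has $$\liminf_{X\to\infty}\delta_{p,n}(X)\geq 1-\hat\varepsilon(p).$$ -/

import Mathlib

open Polynomial Filter Topology

noncomputable section

/-- A prime `p` is totally ramified in the number field `K`: one has `(p) = P ^ [K : ℚ]` for some
prime ideal `P` of the ring of integers. -/
def IsTotallyRamifiedPrime (K : Type*) [Field K] [NumberField K] (p : ℕ) : Prop :=
  p.Prime ∧ ∃ P : Ideal (NumberField.RingOfIntegers K), P.IsPrime ∧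
    Ideal.span {(p : NumberField.RingOfIntegers K)} = P ^ Module.finrank ℚ K

/-- The integer `a` is the norm of an algebraic integer of `K`. -/
def IsIntegerNorm (K : Type*) [Field K] [NumberField K] (a : ℤ) : Prop :=
  ∃ α : NumberField.RingOfIntegers K, Algebra.norm ℤ α = a

/-- `a` is an `n`-th power residue modulo `p`. -/
def IsPowerResidue (n p : ℕ) (a : ℤ) : Prop :=
  ∃ x : ℤ, x ^ n ≡ a [ZMOD p]

/-- Heilbronn's criterion applies to the number field `K` of degree `n`: some prime `p` that is
totally ramified in `K` can be written as `p = a + b` with positive integers `a`, `b` such that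
neither `a` nor `-b` is a norm and `a` is an `n`-th power residue modulo `p`. -/
def HeilbronnCriterion (K : Type*) [Field K] [NumberField K] : Prop :=
  ∃ p : ℕ, IsTotallyRamifiedPrime K p ∧
    ∃ a b : ℤ, 0 < a ∧ 0 < b ∧ (p : ℤ) = a + b ∧
      ¬ IsIntegerNorm K a ∧ ¬ IsIntegerNorm K (-b) ∧
      IsPowerResidue (Module.finrank ℚ K) p a

/-- Heilbronn's criterion applies to the polynomial `f`: the ring `ℚ[x]/(f)` is a field and the
criterion applies to this number field. -/
def HeilbronnApplies (f : ℤ[X]) : Prop :=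
  ∃ h : Irreducible (f.map (Int.castRingHom ℚ)),
    haveI : Fact (Irreducible (f.map (Int.castRingHom ℚ))) := ⟨h⟩
    HeilbronnCriterion (AdjoinRoot (f.map (Int.castRingHom ℚ)))

/-- The monic integer polynomials of degree `n` that are Eisenstein at `p`. -/
def EisensteinFamily (p n : ℕ) : Set ℤ[X] :=
  {f | f.Monic ∧ f.natDegree = n ∧ f.IsEisensteinAt (Ideal.span {(p : ℤ)})}

/-- The number of `f ∈ F` of height at most `X`, the height of `f` being the maximum of the
absolute values of its coefficients. -/
def heightCount (F : Set ℤ[X]) (X : ℝ) : ℕ :=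
  {f | f ∈ F ∧ f.supNorm ≤ X}.ncard

/-- The proportion of polynomials of height at most `X` in the monic degree `n` polynomials
Eisenstein at `p` to which Heilbronn's criterion applies. -/
def heilbronnProportion (p n : ℕ) (X : ℝ) : ℝ :=
  (heightCount {f | f ∈ EisensteinFamily p n ∧ HeilbronnApplies f} X : ℝ) /
    heightCount (EisensteinFamily p n) X

/-- A computable sequence of real numbers: an algorithm, given `m` and `k`, outputs a dyadic
rational (a difference of two natural numbers over `2 ^ k`) at distance at most `2 ^ (-k)`
from `x m`. -/
def IsComputableRealSeq (x : ℕ → ℝ) : Prop :=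
  ∃ a b : ℕ → ℕ → ℕ, Computable₂ a ∧ Computable₂ b ∧
    ∀ m k : ℕ, |x m - ((a m k : ℝ) - (b m k : ℝ)) / 2 ^ k| ≤ 1 / 2 ^ k

/-- `x m → 0` effectively: there is a computable modulus of convergence. -/
def TendsToZeroEffectively (x : ℕ → ℝ) : Prop :=
  ∃ N : ℕ → ℕ, Computable N ∧ ∀ k m : ℕ, N k ≤ m → |x m| ≤ 1 / 2 ^ k

end

/-! If `f` is Eisenstein at `p`, then `p` is totally ramified, so the criterion may be tried at `p`
itself. Suppose a prime `q` divides `a` exactly once. If `a` is a norm, some prime ideal has norm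
`q`, and reducing a root of `f` modulo it gives a root of `f` in `ZMod q`. So a splitting `p = a +
b` works as soon as `a` is an `n`-th power residue and there are primes `q`, `r` exactly dividing
`a`, `b` such that `f` has no root modulo `q` or `r` (`heilbronnApplies_of_no_root`).

The gcd hypothesis gives at least about `√p (log p)²` residues `a`. At most `2 ^ |S| √p (1 + log p)`
integers below `p` have all their exact prime divisors in a finite set `S`
(`card_exactPrimesIn_le`). A greedy choice therefore yields `K`, of order `log log p`, splittings
whose primes are all distinct (`exists_coprime_isExactSplitting`).

A polynomial of degree at least 2 has no root modulo a given prime with probability at least 1/6,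
uniformly in the prime and the degree (`card_pow_le_six_mul_card_no_root`). By the Chinese remainder
theorem the `K` tests are independent of each other and of the Eisenstein condition, and each
succeeds with probability at least 1/36. All fail with probability at most `(35/36) ^ K`, which
serves as the error term. -/

/-! ### Total ramification and the obstruction to being a norm -/

/-- The coefficients of an Eisenstein polynomial, evaluated at a root, express the constant term
as an element of high order. -/
theorem natCast_mem_pow_of_isEisensteinAt {R : Type*} [CommRing R] {f : ℤ[X]} {p : ℕ}
    (hp : p.Prime) (hf : f.Monic) (hE : f.IsEisensteinAt (Ideal.span {(p : ℤ)})) {θ : R}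
    (hθ : aeval θ f = 0) {P : Ideal R} (hθP : θ ∈ P) {k : ℕ} (hk : 1 ≤ k)
    (hkn : k < f.natDegree) (hpk : (p : R) ∈ P ^ k) : (p : R) ∈ P ^ (k + 1) := by
  have hmem : ∀ i < f.natDegree, ∃ c : ℤ, f.coeff i = p * c := fun i hi =>
    Ideal.mem_span_singleton.1 (hE.mem hi)
  obtain ⟨n, hn⟩ : ∃ n, f.natDegree = n + 1 := ⟨f.natDegree - 1, by omega⟩
  rw [aeval_eq_sum_range, Finset.sum_range_succ, hn, Finset.sum_range_succ', ← hn,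
    hf.coeff_natDegree] at hθ
  have h1 : θ ^ f.natDegree ∈ P ^ (k + 1) :=
    Ideal.pow_le_pow_right hkn (Ideal.pow_mem_pow hθP _)
  have h2 : ∑ i ∈ Finset.range n, f.coeff (i + 1) • θ ^ (i + 1) ∈ P ^ (k + 1) := by
    refine Ideal.sum_mem _ fun i hi => ?_
    rw [Finset.mem_range] at hi
    obtain ⟨c, hc⟩ := hmem (i + 1) (by omega)
    rw [hc, zsmul_eq_mul, pow_succ P, show (((p * c : ℤ) : R) * θ ^ (i + 1))
      = (p : R) * (c * θ ^ i * θ) by push_cast; ring]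
    exact Ideal.mul_mem_mul hpk (P.mul_mem_left _ hθP)
  obtain ⟨u, hu⟩ := hmem 0 (by omega)
  have h3 : (p : R) * u ∈ P ^ (k + 1) := by
    have : (p : R) * u = -(θ ^ f.natDegree)
        - ∑ i ∈ Finset.range n, f.coeff (i + 1) • θ ^ (i + 1) := by
      rw [hu] at hθ
      simp only [pow_zero, zsmul_eq_mul, mul_one, one_smul, Int.cast_mul, Int.cast_natCast] at hθ ⊢
      linear_combination hθ
    rw [this]
    exact Ideal.sub_mem _ (neg_mem h1) h2
  -- The constant term is `p * u` with `u` prime to `p`, so a Bézout relation recovers `p` from `p *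
  -- p` and `p * u`, both of order at least `k + 1`.
  have hcop : IsCoprime (p : ℤ) u := by
    refine (Nat.prime_iff_prime_int.1 hp).coprime_iff_not_dvd.2 fun ⟨w, hw⟩ => hE.notMem ?_
    rw [Ideal.span_singleton_pow, Ideal.mem_span_singleton]
    exact ⟨w, by rw [hu, hw]; ring⟩
  obtain ⟨s, t, hst⟩ := hcop
  have h4 : (p : R) * p ∈ P ^ (k + 1) := by
    refine Ideal.pow_le_pow_right (by omega : k + 1 ≤ k + k) ?_
    rw [pow_add]
    exact Ideal.mul_mem_mul hpk hpk
  have h5 : (p : R) = s * (p * p) + t * (p * u) := by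
    have : ((s * p + t * u : ℤ) : R) = 1 := by rw [hst]; simp
    push_cast at this
    linear_combination -(p : R) * this
  rw [h5]
  exact add_mem (Ideal.mul_mem_left _ _ h4) (Ideal.mul_mem_left _ _ h3)

/-- For a prime `P` above `p`, the root lies in `P` because `θ ^ n` is a multiple of `p`. Induction
raises the order of `p` at `P` to `n`. Since `(p)` has norm `p ^ n`, nothing is left for the
cofactor of `P ^ n`. -/
theorem isTotallyRamifiedPrime_of_isEisensteinAt {K : Type*} [Field K] [NumberField K]
    {f : ℤ[X]} {p : ℕ} (hp : p.Prime) (hf : f.Monic)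
    (hE : f.IsEisensteinAt (Ideal.span {(p : ℤ)})) (hn : f.natDegree = Module.finrank ℚ K)
    {θ : NumberField.RingOfIntegers K} (hθ : aeval θ f = 0) : IsTotallyRamifiedPrime K p := by
  have hpos : 0 < Module.finrank ℚ K := Module.finrank_pos
  have hnorm : Ideal.absNorm (Ideal.span {(p : NumberField.RingOfIntegers K)}) =
      p ^ Module.finrank ℚ K := by
    rw [Ideal.absNorm_span_natCast, NumberField.RingOfIntegers.rank]
  obtain ⟨P, hPmax, -, hPp⟩ := Ideal.exists_isMaximal_dvd_of_dvd_absNorm' hp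
    (Ideal.span {(p : NumberField.RingOfIntegers K)}) (hnorm ▸ dvd_pow_self p hpos.ne')
  have hpP : (p : NumberField.RingOfIntegers K) ∈ P :=
    Ideal.dvd_iff_le.1 hPp (Ideal.mem_span_singleton_self _)
  have hθP : θ ∈ P := by
    refine hPmax.isPrime.mem_of_pow_mem f.natDegree ?_
    rw [aeval_eq_sum_range, Finset.sum_range_succ, hf.coeff_natDegree, one_smul] at hθ
    rw [eq_neg_of_add_eq_zero_right hθ]
    refine neg_mem (Ideal.sum_mem _ fun i hi => ?_)
    obtain ⟨c, hc⟩ := Ideal.mem_span_singleton.1 (hE.mem (Finset.mem_range.1 hi))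
    rw [hc, zsmul_eq_mul]
    push_cast
    rw [mul_assoc]
    exact P.mul_mem_right _ hpP
  have key : ∀ k, 1 ≤ k → k ≤ f.natDegree → (p : NumberField.RingOfIntegers K) ∈ P ^ k := by
    intro k hk
    induction k, hk using Nat.le_induction with
    | base => intro _; simpa using hpP
    | succ k hk ih =>
      intro hkn
      exact natCast_mem_pow_of_isEisensteinAt hp hf hE hθ hθP hk hkn (ih (by omega))
  obtain ⟨J, hJ⟩ : P ^ Module.finrank ℚ K ∣ Ideal.span {(p : NumberField.RingOfIntegers K)} := by
    rw [Ideal.dvd_iff_le, Ideal.span_singleton_le_iff_mem, ← hn]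
    exact key _ (by omega) le_rfl
  refine ⟨hp, P, hPmax.isPrime, ?_⟩
  have hPdvd : Ideal.absNorm P ∣ p ^ Module.finrank ℚ K :=
    hnorm ▸ Ideal.absNorm_dvd_absNorm_of_le (Ideal.dvd_iff_le.1 hPp)
  obtain ⟨e, -, he⟩ := (Nat.dvd_prime_pow hp).1 hPdvd
  have he0 : e ≠ 0 := by
    rintro rfl
    exact hPmax.ne_top (Ideal.absNorm_eq_one_iff.1 (by simpa using he))
  have hmul : (p ^ e) ^ Module.finrank ℚ K * Ideal.absNorm J = p ^ Module.finrank ℚ K := by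
    rw [← he, ← hnorm, hJ, map_mul, map_pow]
  have hJ1 : Ideal.absNorm J = 1 := by
    have hle : p ^ Module.finrank ℚ K ≤ (p ^ e) ^ Module.finrank ℚ K :=
      Nat.pow_le_pow_left (Nat.le_self_pow he0 p) _
    have h0 : 0 < p ^ Module.finrank ℚ K := pow_pos hp.pos _
    have h1 : Ideal.absNorm J ≠ 0 := by
      intro h; rw [h, mul_zero] at hmul; omega
    by_contra h2
    have : 2 ≤ Ideal.absNorm J := by omega
    nlinarith
  rw [hJ, Ideal.absNorm_eq_one_iff.1 hJ1, Ideal.mul_top]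

/-- If a prime `q` divides the norm `a` exactly once, then `𝓞 K` has `ZMod q` as a quotient. -/
theorem exists_ringHom_zmod_of_isIntegerNorm {K : Type*} [Field K] [NumberField K] {a : ℤ}
    {q : ℕ} (hq : q.Prime) (hqa : (q : ℤ) ∣ a) (hq2 : ¬ (q : ℤ) ^ 2 ∣ a)
    (ha : IsIntegerNorm K a) : Nonempty (NumberField.RingOfIntegers K →+* ZMod q) := by
  obtain ⟨α, hα⟩ := ha
  have hnorm : Ideal.absNorm (Ideal.span {α}) = a.natAbs := by
    rw [Ideal.absNorm_span_singleton, hα]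
  obtain ⟨Q, hQ, hQq, hQα⟩ := Ideal.exists_isMaximal_dvd_of_dvd_absNorm' hq
    (Ideal.span {α}) (by rw [hnorm]; exact Int.natCast_dvd.1 hqa)
  have hqQ : (q : NumberField.RingOfIntegers K) ∈ Q := by
    have : (q : ℤ) ∈ Q.under ℤ := hQq ▸ Ideal.mem_span_singleton_self _
    simpa [Ideal.mem_comap] using this
  have h1 : Ideal.absNorm Q ∣ q ^ Module.finrank ℤ (NumberField.RingOfIntegers K) := by
    rw [← Ideal.absNorm_span_natCast]
    exact Ideal.absNorm_dvd_absNorm_of_le ((Ideal.span_singleton_le_iff_mem _).2 hqQ)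
  obtain ⟨e, -, he⟩ := (Nat.dvd_prime_pow hq).1 h1
  have h2 : Ideal.absNorm Q ∣ a.natAbs :=
    hnorm ▸ Ideal.absNorm_dvd_absNorm_of_le (Ideal.dvd_iff_le.1 hQα)
  -- The norm `q ^ e` of `Q` divides `a`, which excludes `e ≥ 2`; the residue field is then the
  -- prime field.
  have he1 : e = 1 := by
    have he0 : e ≠ 0 := by
      rintro rfl
      exact hQ.ne_top (Ideal.absNorm_eq_one_iff.1 (by simpa using he))
    by_contra he1
    apply hq2
    rw [← Int.natCast_pow, Int.natCast_dvd]
    exact (pow_dvd_pow q (by omega : 2 ≤ e)).trans (he ▸ h2)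
  rw [he1, pow_one, Ideal.absNorm_apply, Submodule.cardQuot_apply] at he
  have : Finite (NumberField.RingOfIntegers K ⧸ Q) := Nat.finite_of_card_ne_zero (he ▸ hq.ne_zero)
  have := Fintype.ofFinite (NumberField.RingOfIntegers K ⧸ Q)
  rw [Nat.card_eq_fintype_card] at he
  exact ⟨((ZMod.ringEquivOfPrime _ hq he).symm :
    (NumberField.RingOfIntegers K ⧸ Q) →+* ZMod q).comp (Ideal.Quotient.mk Q)⟩

theorem not_isIntegerNorm_of_no_root {K : Type*} [Field K] [NumberField K] {f : ℤ[X]}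
    {θ : NumberField.RingOfIntegers K} (hθ : aeval θ f = 0) {a : ℤ} {q : ℕ} (hq : q.Prime)
    (hqa : (q : ℤ) ∣ a) (hq2 : ¬ (q : ℤ) ^ 2 ∣ a) (hf : ∀ x : ZMod q, aeval x f ≠ 0) :
    ¬ IsIntegerNorm K a := by
  intro h
  obtain ⟨φ⟩ := exists_ringHom_zmod_of_isIntegerNorm hq hqa hq2 h
  apply hf (φ θ)
  have := congrArg φ hθ
  rw [map_zero, aeval_def, hom_eval₂] at this
  rw [aeval_def, ← this]
  congr 1
  exact RingHom.ext_int _ _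

theorem heilbronnApplies_of_no_root {f : ℤ[X]} {n p : ℕ} (hn : 0 < n) (hp : p.Prime)
    (hf : f ∈ EisensteinFamily p n) {a b q r : ℕ} (ha : 0 < a) (hb : 0 < b) (hab : p = a + b)
    (hres : IsPowerResidue n p a) (hq : q.Prime) (hqa : q ∣ a) (hq2 : ¬ q ^ 2 ∣ a)
    (hr : r.Prime) (hrb : r ∣ b) (hr2 : ¬ r ^ 2 ∣ b)
    (hfq : ∀ x : ZMod q, aeval x f ≠ 0) (hfr : ∀ x : ZMod r, aeval x f ≠ 0) :
    HeilbronnApplies f := by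
  obtain ⟨hm, hdeg, hE⟩ := hf
  have hpi : (Ideal.span {(p : ℤ)}).IsPrime :=
    (Ideal.span_singleton_prime (by exact_mod_cast hp.ne_zero)).2 (Nat.prime_iff_prime_int.1 hp)
  have hirr : Irreducible (f.map (Int.castRingHom ℚ)) :=
    (hm.irreducible_iff_irreducible_map_fraction_map (K := ℚ)).1
      (hE.irreducible hpi hm.isPrimitive (by omega))
  refine ⟨hirr, ?_⟩
  have : Fact (Irreducible (f.map (Int.castRingHom ℚ))) := ⟨hirr⟩
  have hroot : aeval (AdjoinRoot.root (f.map (Int.castRingHom ℚ))) f = 0 := by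
    have := AdjoinRoot.eval₂_root (f.map (Int.castRingHom ℚ))
    rw [eval₂_map] at this
    rw [aeval_def, ← this]
    congr 1
  have hfin : Module.finrank ℚ (AdjoinRoot (f.map (Int.castRingHom ℚ))) = n := by
    rw [(AdjoinRoot.powerBasis hirr.ne_zero).finrank, AdjoinRoot.powerBasis_dim, hm.natDegree_map,
      hdeg]
  obtain ⟨θ, hθ⟩ : ∃ θ : NumberField.RingOfIntegers (AdjoinRoot (f.map (Int.castRingHom ℚ))),
      aeval θ f = 0 := by
    have hint : IsIntegral ℤ (AdjoinRoot.root (f.map (Int.castRingHom ℚ))) := ⟨f, hm, by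
      rw [← hroot, aeval_def]⟩
    refine ⟨⟨AdjoinRoot.root _, hint⟩, NumberField.RingOfIntegers.coe_injective ?_⟩
    rw [map_zero, ← hroot]
    exact (aeval_algebraMap_apply _ _ _).symm
  refine ⟨p, isTotallyRamifiedPrime_of_isEisensteinAt hp hm hE (hdeg.trans hfin.symm) hθ, a, b,
    by exact_mod_cast ha, by exact_mod_cast hb, by exact_mod_cast hab,
    not_isIntegerNorm_of_no_root hθ hq (by exact_mod_cast hqa) (by exact_mod_cast hq2) hfq,
    not_isIntegerNorm_of_no_root hθ hr ?_ ?_ hfr, by rwa [hfin]⟩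
  · rw [dvd_neg]; exact_mod_cast hrb
  · rw [dvd_neg]; exact_mod_cast hr2

/-! ### Power residues and splittings with new exact prime divisors -/

open Classical in
/-- The `n`-th power residues modulo `p` in the interval `(0, p)`. -/
noncomputable def powerResidues (n p : ℕ) : Finset ℕ :=
  {a ∈ Finset.Ioo 0 p | IsPowerResidue n p (a : ℤ)}

theorem mem_powerResidues {n p a : ℕ} :
    a ∈ powerResidues n p ↔ (0 < a ∧ a < p) ∧ IsPowerResidue n p (a : ℤ) := by
  simp [powerResidues]

/-- The `n`-th powers form a subgroup of index `gcd (p - 1, n)` in the cyclic group of units. -/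
theorem sub_one_le_card_powerResidues_mul_gcd (n : ℕ) {p : ℕ} (hp : p.Prime) :
    p - 1 ≤ (powerResidues n p).card * Nat.gcd (p - 1) n := by
  have : Fact p.Prime := ⟨hp⟩
  have hcard : Nat.card (ZMod p)ˣ = p - 1 := by
    rw [Nat.card_eq_fintype_card, ZMod.card_units]
  have h1 := IsCyclic.card_powMonoidHom_range (G := (ZMod p)ˣ) n
  rw [hcard] at h1
  have h2 : Nat.card (powMonoidHom n : (ZMod p)ˣ →* (ZMod p)ˣ).range
      ≤ (powerResidues n p).card := by
    rw [Nat.card_eq_fintype_card, ← Finset.card_univ]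
    refine Finset.card_le_card_of_injOn (fun u => ((u : (ZMod p)ˣ) : ZMod p).val) ?_ ?_
    · rintro ⟨_, v, rfl⟩ -
      simp only [powerResidues, Finset.coe_filter, Finset.mem_Ioo, Set.mem_ofPred_eq]
      refine ⟨⟨Nat.pos_of_ne_zero fun h => ?_, ZMod.val_lt _⟩, (v : ZMod p).val, ?_⟩
      · rw [ZMod.val_eq_zero] at h
        exact Units.ne_zero _ h
      · rw [← ZMod.intCast_eq_intCast_iff]
        simp
    · intro u _ v _ huv
      exact Subtype.ext (Units.ext (ZMod.val_injective p huv))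
  rw [h1] at h2
  calc p - 1 = (p - 1) / (p - 1).gcd n * (p - 1).gcd n :=
        (Nat.div_mul_cancel (Nat.gcd_dvd_left _ _)).symm
    _ ≤ _ := Nat.mul_le_mul_right _ h2

/-- The `a` in `(0, p)` such that all primes dividing `a` exactly once are in `S`. -/
def exactPrimesIn (p : ℕ) (S : Finset ℕ) : Set ℕ :=
  {a | 0 < a ∧ a < p ∧ ∀ q, q.Prime → q ∣ a → ¬ q ^ 2 ∣ a → q ∈ S}

/-- Write `a = x ^ 2 * b` with `b` squarefree. A prime of `b` outside `S` has odd exponent at least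
3 in `a`, so it divides `x`. With `y` the product of these primes and `x = y * z`, they contribute
the cube. -/
theorem exists_eq_mul_of_mem_exactPrimesIn {p a : ℕ} {S : Finset ℕ}
    (ha : a ∈ exactPrimesIn p S) :
    ∃ T ⊆ S, ∃ y z : ℕ, 0 < y ∧ 0 < z ∧ (y * z) ^ 2 ≤ p ∧ a = (∏ q ∈ T, q) * y ^ 3 * z ^ 2 := by
  obtain ⟨h0, hlt, hS⟩ := ha
  obtain ⟨b, x, hxb, hb⟩ := Nat.sq_mul_squarefree a
  have hx0 : x ≠ 0 := by rintro rfl; simp at hxb; omega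
  have hprod := Nat.prod_primeFactors_of_squarefree hb
  rw [← Finset.prod_inter_mul_prod_sdiff b.primeFactors S] at hprod
  have hyx : ∏ q ∈ b.primeFactors \ S, q ∣ x := by
    refine Finset.prod_primes_dvd _ (fun q hq => ?_) fun q hq => ?_
    · exact (Nat.prime_of_mem_primeFactors (Finset.mem_sdiff.1 hq).1).prime
    · obtain ⟨hqb, hqS⟩ := Finset.mem_sdiff.1 hq
      have hqp := Nat.prime_of_mem_primeFactors hqb
      obtain ⟨c, hc⟩ := Nat.dvd_of_mem_primeFactors hqb
      have hqa : q ^ 2 ∣ a := by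
        by_contra h
        exact hqS (hS q hqp (hxb ▸ (Dvd.intro _ hc.symm).mul_left _) h)
      have h1 : q * q ∣ q * (x ^ 2 * c) := by
        rw [show q * (x ^ 2 * c) = x ^ 2 * (q * c) by ring, ← hc, hxb, ← sq]; exact hqa
      rcases hqp.dvd_mul.1 (Nat.dvd_of_mul_dvd_mul_left hqp.pos h1) with h | h
      · exact hqp.dvd_of_dvd_pow h
      · obtain ⟨d, rfl⟩ := h
        exact absurd (hb q ⟨d, by rw [hc]; ring⟩) hqp.not_isUnit
  obtain ⟨z, hz⟩ := hyx
  refine ⟨b.primeFactors ∩ S, Finset.inter_subset_right, ∏ q ∈ b.primeFactors \ S, q, z,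
    Nat.pos_of_ne_zero fun h => hx0 (by rw [hz, h, zero_mul]),
    Nat.pos_of_ne_zero fun h => hx0 (by rw [hz, h, mul_zero]), ?_, ?_⟩
  · rw [← hz]
    have : 0 < b := hb.ne_zero.bot_lt
    nlinarith
  · conv_lhs => rw [← hxb, ← hprod, hz]
    ring

/-- An upper bound, up to a power of two, for the number of elements of `exactPrimesIn p S`. -/
def powerfulBound (p : ℕ) : ℕ := ∑ y ∈ Finset.Icc 1 p, p.sqrt / y

open Classical in
-- Such an `a` is determined by a subset of `S` and a pair `y, z` with `y * z ≤ √p`.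
theorem card_exactPrimesIn_le (p : ℕ) (S : Finset ℕ) :
    ((Finset.Ioo 0 p).filter (· ∈ exactPrimesIn p S)).card ≤ 2 ^ S.card * powerfulBound p := by
  have hsub : (Finset.Ioo 0 p).filter (· ∈ exactPrimesIn p S) ⊆
      (S.powerset ×ˢ (Finset.Icc 1 p).sigma fun y => Finset.Icc 1 (p.sqrt / y)).image
        fun t => (∏ q ∈ t.1, q) * t.2.1 ^ 3 * t.2.2 ^ 2 := by
    intro a ha
    obtain ⟨T, hT, y, z, hy, hz, hyz, rfl⟩ :=
      exists_eq_mul_of_mem_exactPrimesIn (Finset.mem_filter.1 ha).2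
    refine Finset.mem_image.2 ⟨(T, ⟨y, z⟩), ?_, rfl⟩
    have h1 : y * z ≤ p.sqrt := Nat.le_sqrt'.2 hyz
    simp only [Finset.mem_product, Finset.mem_powerset, Finset.mem_sigma, Finset.mem_Icc]
    refine ⟨hT, ⟨hy, ?_⟩, hz, (Nat.le_div_iff_mul_le hy).2 (by rwa [mul_comm])⟩
    exact (Nat.le_mul_of_pos_right y hz).trans (h1.trans (Nat.sqrt_le_self p))
  refine (Finset.card_le_card hsub).trans (Finset.card_image_le.trans ?_)
  simp [powerfulBound]

theorem powerfulBound_le (p : ℕ) : (powerfulBound p : ℝ) ≤ √p * (1 + Real.log p) := by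
  have h : (∑ y ∈ Finset.Icc 1 p, (y : ℝ)⁻¹) ≤ 1 + Real.log p := by
    have := harmonic_le_one_add_log p
    rw [harmonic_eq_sum_Icc] at this
    push_cast at this
    exact this
  refine le_trans ?_ (mul_le_mul_of_nonneg_left h (Real.sqrt_nonneg _))
  rw [powerfulBound, Nat.cast_sum, Finset.mul_sum]
  refine Finset.sum_le_sum fun y _ => Nat.cast_div_le.trans ?_
  rw [div_eq_mul_inv]
  gcongr
  exact Real.nat_sqrt_le_real_sqrt

/-- `p = a + (p - a)` where the prime `q` exactly divides `a` and the prime `r` exactly divides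
`p - a`. -/
structure IsExactSplitting (p a q r : ℕ) : Prop where
  prime_left : q.Prime
  prime_right : r.Prime
  dvd_left : q ∣ a
  dvd_right : r ∣ p - a
  not_sq_dvd_left : ¬ q ^ 2 ∣ a
  not_sq_dvd_right : ¬ r ^ 2 ∣ p - a

open Classical in
-- The bad `a` form `B` and its reflection under `a ↦ p - a`, whence the factor 2; a larger `A`
-- cannot lie inside their union.
theorem exists_isExactSplitting {p : ℕ} {A S : Finset ℕ} (hA : A ⊆ Finset.Ioo 0 p)
    (hcard : 2 * 2 ^ S.card * powerfulBound p < A.card) :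
    ∃ a ∈ A, ∃ q r, IsExactSplitting p a q r ∧ q ∉ S ∧ r ∉ S := by
  set B := (Finset.Ioo 0 p).filter (· ∈ exactPrimesIn p S)
  have hB := card_exactPrimesIn_le p S
  have h2 : (B ∪ B.image (p - ·)).card < A.card := by
    refine lt_of_le_of_lt ((Finset.card_union_le _ _).trans
      (add_le_add hB (Finset.card_image_le.trans hB))) ?_
    linarith
  obtain ⟨a, haA, haB⟩ := Finset.exists_mem_notMem_of_card_lt_card h2
  rw [Finset.mem_union, not_or] at haB
  have hI := Finset.mem_Ioo.1 (hA haA)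
  have h3 : ∃ q, q.Prime ∧ q ∣ a ∧ ¬ q ^ 2 ∣ a ∧ q ∉ S := by
    by_contra! h
    exact haB.1 (Finset.mem_filter.2 ⟨hA haA, hI.1, hI.2, h⟩)
  have h4 : ∃ q, q.Prime ∧ q ∣ p - a ∧ ¬ q ^ 2 ∣ p - a ∧ q ∉ S := by
    by_contra! h
    refine haB.2 (Finset.mem_image.2 ⟨p - a, Finset.mem_filter.2 ⟨?_, ?_, ?_, h⟩, ?_⟩)
    · rw [Finset.mem_Ioo]; omega
    · omega
    · omega
    · omega
  obtain ⟨q, hq1, hq2, hq3, hq4⟩ := h3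
  obtain ⟨r, hr1, hr2, hr3, hr4⟩ := h4
  exact ⟨a, haA, q, r, ⟨hq1, hr1, hq2, hr2, hq3, hr3⟩, hq4, hr4⟩

/-- Greedy choice: `S` collects the primes already used, at most two per splitting, so `2 ^ |S| ≤ 4
^ k` at stage `k`. -/
theorem exists_coprime_isExactSplitting {p : ℕ} {A : Finset ℕ} (hA : A ⊆ Finset.Ioo 0 p) (K : ℕ)
    (hcard : ∀ k < K, 2 * 4 ^ k * powerfulBound p < A.card) :
    ∃ a q r : ℕ → ℕ, (∀ i < K, a i ∈ A ∧ IsExactSplitting p (a i) (q i) (r i)) ∧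
      ∀ i < K, ∀ j < i, Nat.Coprime (q i * r i) (q j * r j) := by
  induction K with
  | zero => exact ⟨0, 0, 0, by simp, by simp⟩
  | succ K ih =>
    obtain ⟨a, q, r, h1, h2⟩ := ih fun k hk => hcard k (by omega)
    set S := (Finset.range K).image q ∪ (Finset.range K).image r with hS
    have hSc : S.card ≤ 2 * K := by
      have h3 := Finset.card_image_le (s := Finset.range K) (f := q)
      have h4 := Finset.card_image_le (s := Finset.range K) (f := r)
      have h5 := Finset.card_union_le ((Finset.range K).image q) ((Finset.range K).image r)
      rw [Finset.card_range] at h3 h4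
      rw [← hS] at h5
      omega
    obtain ⟨a', ha', q', r', hs, hq, hr⟩ := exists_isExactSplitting (S := S) hA <| by
      refine lt_of_le_of_lt ?_ (hcard K (by omega))
      refine Nat.mul_le_mul_right _ (Nat.mul_le_mul_left _ ?_)
      calc 2 ^ S.card ≤ 2 ^ (2 * K) := Nat.pow_le_pow_right (by omega) hSc
        _ = 4 ^ K := by rw [pow_mul]; norm_num
    refine ⟨Function.update a K a', Function.update q K q', Function.update r K r', ?_, ?_⟩
    · intro i hi
      rcases Nat.lt_succ_iff_lt_or_eq.1 hi with hi | rfl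
      · simpa [hi.ne] using h1 i hi
      · simpa using ⟨ha', hs⟩
    · intro i hi j hj
      rcases Nat.lt_succ_iff_lt_or_eq.1 hi with hi | rfl
      · simpa [hi.ne, (hj.trans hi).ne] using h2 i hi j hj
      · have hqS : q j ∈ S := Finset.mem_union_left _
          (Finset.mem_image_of_mem _ (Finset.mem_range.2 hj))
        have hrS : r j ∈ S := Finset.mem_union_right _
          (Finset.mem_image_of_mem _ (Finset.mem_range.2 hj))
        obtain ⟨-, hj'⟩ := h1 j hj
        have hc : ∀ {s t}, s.Prime → t.Prime → s ∉ S → t ∈ S → s.Coprime t :=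
          fun hs ht hsS htS => (Nat.coprime_primes hs ht).2 fun h => hsS (h ▸ htS)
        simp only [Function.update_self, Function.update_of_ne hj.ne]
        exact Nat.Coprime.mul_left
          (Nat.Coprime.mul_right (hc hs.prime_left hj'.prime_left hq hqS)
            (hc hs.prime_left hj'.prime_right hq hrS))
          (Nat.Coprime.mul_right (hc hs.prime_right hj'.prime_left hr hqS)
            (hc hs.prime_right hj'.prime_right hr hrS))

/-- With `L = log p`, there are at least `√p L² / 2` residues, against at most `4 ^ K √p L` excluded
ones. The 10 in the threshold gives `6 * 4 ^ K ≤ L`, as `10 log 2 > 6`. -/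
theorem mul_powerfulBound_lt_card_powerResidues {n p K k : ℕ} (hp : p.Prime)
    (hgcd : (Nat.gcd (p - 1) n : ℝ) < (p : ℝ) ^ (1 / 2 : ℝ) / Real.log p ^ 2)
    (hK : 2 ^ (10 * 4 ^ K) ≤ p) (hk : k < K) :
    2 * 4 ^ k * powerfulBound p < (powerResidues n p).card := by
  rw [← Real.sqrt_eq_rpow] at hgcd
  have hlog : 6 * 4 ^ K ≤ Real.log p := by
    have h1 : Real.log ((2 : ℝ) ^ (10 * 4 ^ K)) ≤ Real.log p :=
      Real.log_le_log (by positivity) (by exact_mod_cast hK)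
    rw [Real.log_pow] at h1
    push_cast at h1
    have := Real.log_two_gt_d9
    have h4 : (0 : ℝ) < 4 ^ K := by positivity
    nlinarith
  have hkK : (4 : ℝ) * 4 ^ k ≤ 4 ^ K := by
    rw [← pow_succ']
    exact pow_le_pow_right₀ (by norm_num) hk
  have h1k : (1 : ℝ) ≤ 4 ^ k := one_le_pow₀ (by norm_num)
  have hp2 : (2 : ℝ) ≤ p := by exact_mod_cast hp.two_le
  set L := Real.log p
  have hL : 1 ≤ L := by linarith
  set s := √(p : ℝ)
  have hs : s * s = p := Real.mul_self_sqrt (by linarith)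
  have hs0 : 0 < s := Real.sqrt_pos.2 (by linarith)
  set C := ((powerResidues n p).card : ℝ)
  have hC0 : 0 ≤ C := Nat.cast_nonneg _
  have hC : (p : ℝ) - 1 ≤ C * (s / L ^ 2) := by
    have h := sub_one_le_card_powerResidues_mul_gcd n hp
    have h' : ((p - 1 : ℕ) : ℝ) ≤ C * (Nat.gcd (p - 1) n : ℝ) := by
      rw [← Nat.cast_mul]
      exact Nat.cast_le.2 h
    rw [Nat.cast_sub hp.one_le, Nat.cast_one] at h'
    exact h'.trans (mul_le_mul_of_nonneg_left hgcd.le hC0)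
  have hC' : (p - 1) * L ^ 2 ≤ C * s := by
    rw [mul_div_assoc', le_div_iff₀ (by positivity)] at hC
    exact hC
  have hCs : s * L ^ 2 / 2 ≤ C := by
    refine le_of_mul_le_mul_right ?_ hs0
    refine le_trans ?_ hC'
    have : s * L ^ 2 / 2 * s = p / 2 * L ^ 2 := by rw [← hs]; ring
    rw [this]
    gcongr
    linarith
  have hW := powerfulBound_le p
  have : (2 * 4 ^ k * powerfulBound p : ℝ) < C := by
    calc (2 * 4 ^ k * powerfulBound p : ℝ) ≤ 2 * 4 ^ k * (s * (1 + L)) := by gcongr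
      _ ≤ 2 * 4 ^ k * (s * (2 * L)) := by gcongr; linarith
      _ = (4 * 4 ^ k) * (s * L) := by ring
      _ ≤ (L / 6) * (s * L) := by
        gcongr
        rw [le_div_iff₀ (by norm_num)]
        linarith
      _ < s * L ^ 2 / 2 := by
        have : 0 < s * L ^ 2 := by positivity
        rw [show L / 6 * (s * L) = s * L ^ 2 / 6 by ring]
        linarith
      _ ≤ C := hCs
  rw [← Nat.cast_lt (α := ℝ)]
  push_cast
  exact this

/-! ### Monic polynomials without roots over a finite field -/

section MonicOfCoeffs

variable {R S : Type*} [CommRing R] [CommRing S] {n : ℕ}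

/-- The monic polynomial of degree `n` with the given lower coefficients. -/
noncomputable def monicOfCoeffs {R : Type*} [CommRing R] {n : ℕ} (v : Fin n → R) : R[X] :=
  X ^ n + ∑ i : Fin n, C (v i) * X ^ (i : ℕ)

theorem degree_sum_coeffs_lt (v : Fin n → R) :
    (∑ i : Fin n, C (v i) * X ^ (i : ℕ)).degree < (n : WithBot ℕ) := by
  refine (degree_sum_le _ _).trans_lt ((Finset.sup_lt_iff (WithBot.bot_lt_coe n)).2 fun i _ => ?_)
  exact (degree_C_mul_X_pow_le _ _).trans_lt (Nat.cast_lt.2 i.2)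

theorem monic_monicOfCoeffs (v : Fin n → R) : (monicOfCoeffs v).Monic :=
  monic_X_pow_add (degree_sum_coeffs_lt v)

theorem natDegree_monicOfCoeffs [Nontrivial R] (v : Fin n → R) :
    (monicOfCoeffs v).natDegree = n := by
  apply natDegree_eq_of_degree_eq_some
  rw [monicOfCoeffs, degree_add_eq_left_of_degree_lt] <;> rw [degree_X_pow]
  exact degree_sum_coeffs_lt v

theorem coeff_monicOfCoeffs (v : Fin n → R) (i : Fin n) : (monicOfCoeffs v).coeff i = v i := by
  simp [monicOfCoeffs, coeff_X_pow, i.2.ne, Fin.val_inj, Finset.sum_ite_eq]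

theorem monicOfCoeffs_coeff {f : R[X]} (hf : f.Monic) (hn : f.natDegree = n) :
    monicOfCoeffs (fun i : Fin n => f.coeff i) = f := by
  conv_rhs => rw [hf.as_sum, hn]
  rw [monicOfCoeffs, Fin.sum_univ_eq_sum_range (fun i => C (f.coeff i) * X ^ i)]

theorem map_monicOfCoeffs (φ : R →+* S) (v : Fin n → R) :
    (monicOfCoeffs v).map φ = monicOfCoeffs (φ ∘ v) := by
  simp [monicOfCoeffs, Polynomial.map_sum]

theorem eval_monicOfCoeffs (v : Fin n → R) (x : R) :
    (monicOfCoeffs v).eval x = x ^ n + ∑ i : Fin n, v i * x ^ (i : ℕ) := by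
  simp [monicOfCoeffs, eval_finsetSum]

end MonicOfCoeffs

section NoRoot

variable {F : Type*} [Field F] [Fintype F] [DecidableEq F] {n : ℕ}

/-- The number of monic polynomials of degree `n` vanishing on a set of at most `n` points. -/
theorem card_vanishing_mul_pow (S : Finset F) (hS : S.card ≤ n) :
    (Finset.univ.filter fun v : Fin n → F => ∀ x ∈ S, (monicOfCoeffs v).eval x = 0).card
      * Fintype.card F ^ S.card = Fintype.card F ^ n := by
  let T : (Fin n → F) →+ (S → F) :=
    { toFun := fun v x => ∑ i : Fin n, v i * (x : F) ^ (i : ℕ)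
      map_zero' := by ext; simp
      map_add' := fun u v => by ext; simp [add_mul, Finset.sum_add_distrib] }
  -- Lagrange interpolation; here the bound of `|S|` by `n` is needed. All fibres of `T` then have
  -- equal size, and vanishing on `S` is the fibre over `x ↦ -x ^ n`.
  have hT : Function.Surjective T := by
    intro w
    let P : F[X] := Lagrange.interpolate Finset.univ (fun x : S => (x : F)) w
    have hinj : Set.InjOn (fun x : S => (x : F)) (Finset.univ : Finset S) :=
      Subtype.val_injective.injOn
    have hdeg : P.degree < n := by
      refine (Lagrange.degree_interpolate_lt w hinj).trans_le ?_
      simpa using hS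
    refine ⟨fun i => P.coeff i, funext fun x => ?_⟩
    have hx := Lagrange.eval_interpolate_at_node w hinj (Finset.mem_univ x)
    change ∑ i : Fin n, P.coeff i * (x : F) ^ (i : ℕ) = w x
    rw [← hx, Fin.sum_univ_eq_sum_range (fun i => P.coeff i * (x : F) ^ i)]
    change _ = P.eval _
    by_cases h0 : P = 0
    · simp [h0]
    · rw [eval_eq_sum_range' ((natDegree_lt_iff_degree_lt h0).2 hdeg)]
  have hfib : ∀ w : S → F, (Finset.univ.filter fun v => T v = w).card =
      (Finset.univ.filter fun v : Fin n → F =>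
        ∀ x ∈ S, (monicOfCoeffs v).eval x = 0).card := by
    intro w
    rw [AddMonoidHom.card_fiber_eq_of_mem_range T (hT w) (hT fun x => -(x : F) ^ n)]
    congr 1
    ext v
    simp only [Finset.mem_filter, Finset.mem_univ, true_and, eval_monicOfCoeffs, funext_iff,
      Subtype.forall, T, AddMonoidHom.coe_mk, ZeroHom.coe_mk]
    refine forall₂_congr fun x _ => ?_
    rw [eq_neg_iff_add_eq_zero, add_comm]
  have := Finset.card_eq_sum_card_fiberwise (f := T) (s := Finset.univ) (t := Finset.univ)
    (fun _ _ => Finset.mem_coe.2 (Finset.mem_univ _))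
  rw [Finset.sum_congr rfl fun w _ => hfib w, Finset.sum_const, Finset.card_univ,
    Finset.card_univ, smul_eq_mul, mul_comm] at this
  simpa using this.symm

/-- The roots in `F` of the monic polynomial with the given coefficients. -/
noncomputable def rootFinset (v : Fin n → F) : Finset F :=
  Finset.univ.filter fun x => (monicOfCoeffs v).eval x = 0

theorem card_rootFinset_le (v : Fin n → F) : (rootFinset v).card ≤ n := by
  have h : rootFinset v ⊆ (monicOfCoeffs v).roots.toFinset := fun x hx => by
    rw [Multiset.mem_toFinset, mem_roots (monic_monicOfCoeffs v).ne_zero]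
    exact (Finset.mem_filter.1 hx).2
  calc _ ≤ _ := Finset.card_le_card h
    _ ≤ _ := Multiset.toFinset_card_le _
    _ ≤ _ := card_roots' _
    _ = n := natDegree_monicOfCoeffs v

/-- The factorial moments of the number of roots. -/
theorem sum_choose_card_rootFinset_mul (k : ℕ) (hk : k ≤ n) :
    (∑ v : Fin n → F, (rootFinset v).card.choose k) * Fintype.card F ^ k =
      (Fintype.card F).choose k * Fintype.card F ^ n := by
  -- Double counting of pairs of a polynomial and a `k`-set of its roots.
  have h1 : ∀ v : Fin n → F, (rootFinset v).card.choose k =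
      ∑ S ∈ Finset.univ.powersetCard k, if S ⊆ rootFinset v then 1 else 0 := by
    intro v
    rw [← Finset.card_powersetCard, ← Finset.card_filter]
    congr 1
    ext S
    simp [Finset.mem_powersetCard, and_comm]
  simp_rw [h1]
  rw [Finset.sum_comm, Finset.sum_mul, Finset.sum_congr rfl (g := fun _ => Fintype.card F ^ n)]
  · simp
  · intro S hS
    have hS' := (Finset.mem_powersetCard.1 hS).2
    rw [← Finset.card_filter, ← card_vanishing_mul_pow S (hS'.le.trans hk), hS']
    congr 3
    ext v
    simp [rootFinset, Finset.subset_iff]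

/-- At least one sixth of the monic polynomials of degree `n ≥ 2` over a finite field have no
root. -/
theorem card_pow_le_six_mul_card_no_root (hn : 2 ≤ n) :
    Fintype.card F ^ n ≤
      6 * (Finset.univ.filter fun v : Fin n → F => ∀ x, (monicOfCoeffs v).eval x ≠ 0).card := by
  set q := Fintype.card F
  have hq : 2 ≤ q := Fintype.one_lt_card
  have hempty : (Finset.univ.filter fun v : Fin n → F => ∀ x, (monicOfCoeffs v).eval x ≠ 0)
      = Finset.univ.filter fun v : Fin n → F => (rootFinset v).card = 0 := by
    ext v
    simp [rootFinset, Finset.filter_eq_empty_iff]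
  rw [hempty, Finset.card_filter]
  -- Bonferroni's inequality, truncated after the third term and written without subtraction.
  have bonf : ∀ z : ℕ, 1 + z.choose 2 ≤ (if z = 0 then 1 else 0) + z.choose 1 + z.choose 3 := by
    rintro (_ | z)
    · simp
    · rw [Nat.choose_succ_succ' z 1, Nat.choose_succ_succ' z 2, if_neg (Nat.succ_ne_zero z),
        Nat.choose_one_right, Nat.choose_one_right]
      simp only [Nat.reduceAdd]
      omega
  have h1 := sum_choose_card_rootFinset_mul (F := F) (n := n) 1 (by omega)
  have h2 := sum_choose_card_rootFinset_mul (F := F) (n := n) 2 hn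
  -- Only an inequality, since for `n = 2` the third moment is zero.
  have h3 : (∑ v : Fin n → F, (rootFinset v).card.choose 3) * q ^ 3 ≤ q.choose 3 * q ^ n := by
    rcases hn.eq_or_lt with rfl | hn
    · rw [Finset.sum_eq_zero fun v _ =>
        Nat.choose_eq_zero_of_lt ((card_rootFinset_le v).trans_lt (by omega)), zero_mul]
      exact Nat.zero_le _
    · exact (sum_choose_card_rootFinset_mul 3 hn).le
  have hsum := Finset.sum_le_sum fun (v : Fin n → F) (_ : v ∈ Finset.univ) =>
    bonf (rootFinset v).card
  simp only [Finset.sum_add_distrib] at hsum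
  rw [Finset.sum_const, Finset.card_univ, Fintype.card_fun, Fintype.card_fin, smul_eq_mul,
    mul_one] at hsum
  change q ^ n + _ ≤ _ at hsum
  change _ * q ^ 1 = q.choose 1 * q ^ n at h1
  change _ * q ^ 2 = q.choose 2 * q ^ n at h2
  generalize (∑ v : Fin n → F, if (rootFinset v).card = 0 then 1 else 0) = A at hsum ⊢
  generalize (∑ v : Fin n → F, (rootFinset v).card.choose 1) = s₁ at hsum h1
  generalize (∑ v : Fin n → F, (rootFinset v).card.choose 2) = s₂ at hsum h2
  generalize (∑ v : Fin n → F, (rootFinset v).card.choose 3) = s₃ at hsum h3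
  generalize q ^ n = N at hsum h1 h2 h3 ⊢
  obtain ⟨t, ht⟩ : ∃ t, q = t + 2 := ⟨q - 2, by omega⟩
  have c2 : q.choose 2 * 2 = q * (t + 1) := by
    have := Nat.choose_succ_right_eq q 1
    rwa [Nat.choose_one_right, show q - 1 = t + 1 by omega] at this
  have c3 : q.choose 3 * 3 = q.choose 2 * t := by
    have := Nat.choose_succ_right_eq q 2
    rwa [show q - 2 = t by omega] at this
  have e1 : s₁ = N := by
    rw [pow_one, Nat.choose_one_right, mul_comm] at h1
    exact Nat.eq_of_mul_eq_mul_left (by omega) h1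
  have e2 : s₂ ≤ A + s₃ := by omega
  -- The moments give density at least `1 - 1 + (q choose 2)/q² - (q choose 3)/q³ = (q² - 1)/(3q²) ≥
  -- 1/4`; the weaker 1/6 suffices.
  refine Nat.le_of_mul_le_mul_right ?_ (pow_pos (by omega : 0 < q) 3)
  have e3 : 6 * (s₂ * q ^ 2) * q ≤ 6 * A * q ^ 3 + 6 * (s₃ * q ^ 3) := by
    have := Nat.mul_le_mul_right (6 * q ^ 3) e2
    linarith [this]
  have e4 : 6 * (s₂ * q ^ 2) * q = 3 * q ^ 2 * (t + 1) * N := by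
    rw [h2]; linear_combination 3 * q * N * c2
  have e5 : 6 * (s₃ * q ^ 3) ≤ q * (t + 1) * t * N := by
    calc _ ≤ 6 * (q.choose 3 * N) := Nat.mul_le_mul_left _ h3
      _ = _ := by linear_combination 2 * N * c3 + N * t * c2
  have e6 : N * q ^ 3 + q * (t + 1) * t * N ≤ 3 * q ^ 2 * (t + 1) * N := by
    have : q ^ 3 + q * (t + 1) * t ≤ 3 * q ^ 2 * (t + 1) := by rw [ht]; nlinarith
    calc _ = (q ^ 3 + q * (t + 1) * t) * N := by ring
      _ ≤ _ := Nat.mul_le_mul_right _ this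
  omega

end NoRoot

/-! ### Equidistribution of residues in boxes -/

theorem tendsto_card_filter_modEq_div {M : ℕ} (hM : 0 < M) (r : ℤ) :
    Tendsto (fun X : ℝ => (((Finset.Icc (-⌊X⌋) ⌊X⌋).filter fun x => x ≡ r [ZMOD M]).card : ℝ) / X)
      atTop (𝓝 (2 / M)) := by
  rw [tendsto_iff_norm_sub_tendsto_zero]
  refine squeeze_zero' (Eventually.of_forall fun _ => norm_nonneg _) ?_
    ((tendsto_const_nhds (x := (4 : ℝ))).div_atTop tendsto_id)
  filter_upwards [eventually_ge_atTop 1] with X hX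
  have hIcc : Finset.Icc (-⌊X⌋) ⌊X⌋ = Finset.Ioc (-⌊X⌋ - 1) ⌊X⌋ := by
    ext x; simp only [Finset.mem_Icc, Finset.mem_Ioc]; omega
  have hcard := Int.Ioc_filter_modEq_card (-⌊X⌋ - 1) ⌊X⌋ (by exact_mod_cast hM : (0 : ℤ) < M) r
  rw [← hIcc] at hcard
  set c := ((Finset.Icc (-⌊X⌋) ⌊X⌋).filter fun x => x ≡ r [ZMOD M]).card
  set a : ℚ := (((-⌊X⌋ - 1 : ℤ) : ℚ) - r) / ((M : ℤ) : ℚ) with ha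
  set b : ℚ := ((⌊X⌋ : ℚ) - r) / ((M : ℤ) : ℚ) with hb
  have hM1 : (1 : ℚ) ≤ M := by exact_mod_cast hM
  have hba : (b - a) = (2 * ⌊X⌋ + 1) / M := by
    rw [ha, hb]; push_cast; ring
  have hX0 : (1 : ℚ) ≤ ⌊X⌋ := by exact_mod_cast Int.le_floor.2 (by simpa using hX)
  have hba0 : 0 ≤ b - a := by rw [hba]; positivity
  have hcq : (c : ℚ) = max ((⌊b⌋ : ℚ) - ⌊a⌋) 0 := by
    exact_mod_cast congrArg (Int.cast (R := ℚ)) hcard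
  have h1 : (c : ℚ) ≤ b - a + 1 := by
    rw [hcq]
    refine max_le ?_ (by linarith)
    linarith [Int.floor_le b, Int.lt_floor_add_one a]
  have h2 : b - a - 1 ≤ (c : ℚ) := by
    rw [hcq]
    refine le_max_of_le_left ?_
    linarith [Int.floor_le a, Int.lt_floor_add_one b]
  rw [hba] at h1 h2
  have h1' : (c : ℝ) ≤ (2 * ⌊X⌋ + 1) / M + 1 := by exact_mod_cast h1
  have h2' : ((2 * ⌊X⌋ + 1) / M - 1 : ℝ) ≤ c := by exact_mod_cast h2
  have hM1' : (1 : ℝ) ≤ M := by exact_mod_cast hM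
  have hXpos : 0 < X := by linarith
  rw [Real.norm_eq_abs, id, show (c : ℝ) / X - 2 / M = (c - 2 * X / M) / X by field_simp,
    abs_div, abs_of_pos hXpos]
  gcongr
  have h3 : ((2 * ⌊X⌋ + 1) / M : ℝ) ≤ 2 * X / M + 1 := by
    have : ((2 * ⌊X⌋ + 1) / M : ℝ) = 2 * ⌊X⌋ / M + 1 / M := by ring
    rw [this]
    have h4 : (1 : ℝ) / M ≤ 1 := by rw [div_le_one (by linarith)]; exact hM1'
    have h5 : (2 * ⌊X⌋ / M : ℝ) ≤ 2 * X / M := by gcongr; exact Int.floor_le X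
    linarith
  have h4 : (2 * X / M : ℝ) - 1 ≤ (2 * ⌊X⌋ + 1) / M := by
    have : (2 * X / M : ℝ) ≤ (2 * ⌊X⌋ + 2) / M := by
      gcongr; linarith [Int.lt_floor_add_one X]
    have h5 : ((2 * ⌊X⌋ + 2) / M : ℝ) = (2 * ⌊X⌋ + 1) / M + 1 / M := by ring
    have h6 : (1 : ℝ) / M ≤ 1 := by rw [div_le_one (by linarith)]; exact hM1'
    linarith
  rw [abs_le]
  constructor <;> linarith

/-- The integer vectors with coordinates of absolute value at most `X`. -/
noncomputable def intBox (n : ℕ) (X : ℝ) : Finset (Fin n → ℤ) :=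
  Fintype.piFinset fun _ => Finset.Icc (-⌊X⌋) ⌊X⌋

section Residues

variable {ι : Type*} {n : ℕ} (m : ι → ℕ)

/-- The residues of an integer vector modulo several moduli. -/
def residues (v : Fin n → ℤ) (i : ι) (j : Fin n) : ZMod (m i) := v j

variable [Fintype ι] {m}

open Classical in
-- By the Chinese remainder theorem each coordinate satisfies one congruence modulo the product of
-- the moduli, and the count factors over coordinates.
theorem tendsto_card_filter_residues_eq (hm : ∀ i, 0 < m i)
    (hcop : Pairwise (Nat.Coprime.onFun m)) (w : ∀ i, Fin n → ZMod (m i)) :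
    Tendsto (fun X : ℝ => (((intBox n X).filter fun v => residues m v = w).card : ℝ) / X ^ n)
      atTop (𝓝 ((2 / (∏ i, m i : ℕ)) ^ n)) := by
  have hM : 0 < ∏ i, m i := Finset.prod_pos fun i _ => hm i
  have : NeZero (∏ i, m i) := ⟨hM.ne'⟩
  let e := ZMod.prodEquivPi m hcop
  let r : Fin n → ℤ := fun j => ((e.symm fun i => w i j).val : ℤ)
  have key : ∀ (x : ℤ) (j : Fin n), (∀ i, (x : ZMod (m i)) = w i j) ↔
      x ≡ r j [ZMOD (∏ i, m i : ℕ)] := by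
    intro x j
    rw [← ZMod.intCast_eq_intCast_iff]
    have h1 : ((r j : ℤ) : ZMod (∏ i, m i)) = e.symm fun i => w i j := by simp [r]
    rw [h1, RingEquiv.eq_symm_apply, map_intCast, funext_iff]
    simp
  have hfilter : ∀ X : ℝ, ((intBox n X).filter fun v => residues m v = w) =
      Fintype.piFinset fun j : Fin n =>
        (Finset.Icc (-⌊X⌋) ⌊X⌋).filter fun x => x ≡ r j [ZMOD (∏ i, m i : ℕ)] := by
    intro X
    ext v
    simp only [intBox, Finset.mem_filter, Fintype.mem_piFinset, ← key, forall_and, funext_iff,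
      residues]
    rw [forall_comm (α := ι)]
  have hfun : (fun X : ℝ => (((intBox n X).filter fun v => residues m v = w).card : ℝ) / X ^ n) =
      fun X : ℝ => ∏ j : Fin n, (((Finset.Icc (-⌊X⌋) ⌊X⌋).filter
        fun x => x ≡ r j [ZMOD (∏ i, m i : ℕ)]).card : ℝ) / X := by
    ext X
    rw [hfilter, Fintype.card_piFinset, Nat.cast_prod, Finset.prod_div_distrib, Finset.prod_const,
      Finset.card_univ, Fintype.card_fin]
  rw [hfun]
  have := tendsto_finsetProd (Finset.univ : Finset (Fin n)) fun j _ =>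
    tendsto_card_filter_modEq_div hM (r j)
  rwa [Finset.prod_const, Finset.card_univ, Fintype.card_fin] at this

open Classical in
theorem tendsto_card_filter_residues_mem (hm : ∀ i, 0 < m i)
    (hcop : Pairwise (Nat.Coprime.onFun m)) (S : Finset (∀ i, Fin n → ZMod (m i))) :
    Tendsto (fun X : ℝ => (((intBox n X).filter fun v => residues m v ∈ S).card : ℝ) / X ^ n)
      atTop (𝓝 (S.card * (2 / (∏ i, m i : ℕ)) ^ n)) := by
  have hfun : (fun X : ℝ => (((intBox n X).filter fun v => residues m v ∈ S).card : ℝ) / X ^ n) =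
      fun X : ℝ => ∑ w ∈ S,
        (((intBox n X).filter fun v => residues m v = w).card : ℝ) / X ^ n := by
    ext X
    rw [← Finset.sum_div, ← Nat.cast_sum, Finset.card_eq_sum_card_fiberwise
      (s := (intBox n X).filter fun v => residues m v ∈ S) (f := residues m) (t := S)
      fun v hv => (Finset.mem_filter.1 hv).2]
    congr 2
    refine Finset.sum_congr rfl fun w hw => ?_
    rw [Finset.filter_filter]
    congr 1
    refine Finset.filter_congr fun v _ => ?_
    exact ⟨fun h => h.2, fun h => ⟨h ▸ hw, h⟩⟩
  rw [hfun]
  have := tendsto_finsetSum S fun w _ => tendsto_card_filter_residues_eq hm hcop w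
  simpa using this

open Classical in
theorem tendsto_card_filter_residues_div (hm : ∀ i, 0 < m i)
    (hcop : Pairwise (Nat.Coprime.onFun m)) (S T : Finset (∀ i, Fin n → ZMod (m i)))
    (hT : T.Nonempty) :
    Tendsto (fun X : ℝ => (((intBox n X).filter fun v => residues m v ∈ S).card : ℝ) /
      ((intBox n X).filter fun v => residues m v ∈ T).card) atTop (𝓝 (S.card / T.card)) := by
  have hM : 0 < ∏ i, m i := Finset.prod_pos fun i _ => hm i
  have hM' : (2 / (∏ i, m i : ℕ) : ℝ) ^ n ≠ 0 := by positivity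
  have h := (tendsto_card_filter_residues_mem hm hcop S).div
    (tendsto_card_filter_residues_mem hm hcop T)
    (mul_ne_zero (Nat.cast_ne_zero.2 hT.card_pos.ne') hM')
  rw [mul_div_mul_right _ _ hM'] at h
  refine h.congr' ?_
  filter_upwards [eventually_gt_atTop 0] with X hX
  rw [Pi.div_apply, div_div_div_cancel_right₀ (by positivity)]

end Residues

/-! ### Height, Eisenstein condition and root-freeness in terms of coefficient vectors -/

theorem supNorm_monicOfCoeffs_le_iff {n : ℕ} {X : ℝ} (hX : 1 ≤ X) (v : Fin n → ℤ) :
    (monicOfCoeffs v).supNorm ≤ X ↔ v ∈ intBox n X := by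
  have h1 : ∀ z : ℤ, ‖z‖ ≤ X ↔ z ∈ Finset.Icc (-⌊X⌋) ⌊X⌋ := by
    intro z
    rw [Finset.mem_Icc, ← abs_le, Int.le_floor, Int.norm_eq_abs, Int.cast_abs]
  rw [intBox, Fintype.mem_piFinset]
  constructor
  · intro h i
    rw [← h1, ← coeff_monicOfCoeffs v i]
    exact (le_supNorm _ _).trans h
  · intro h
    obtain ⟨i, hi⟩ := exists_eq_supNorm (monicOfCoeffs v)
    rw [hi]
    rcases lt_trichotomy i n with hin | rfl | hin
    · rw [coeff_monicOfCoeffs v ⟨i, hin⟩]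
      exact (h1 _).2 (h _)
    -- The leading coefficient 1 is not seen by the box; this is where `1 ≤ X` enters.
    · have := (monic_monicOfCoeffs v).coeff_natDegree
      rw [natDegree_monicOfCoeffs] at this
      rw [this]
      simpa using hX
    · rw [coeff_eq_zero_of_natDegree_lt (by rwa [natDegree_monicOfCoeffs])]
      simpa using zero_le_one.trans hX

theorem heightCount_eq_card {n : ℕ} {F : Set ℤ[X]}
    [DecidablePred fun v : Fin n → ℤ => monicOfCoeffs v ∈ F] (hF : ∀ f ∈ F, f.Monic ∧ f.natDegree = n)
    {X : ℝ} (hX : 1 ≤ X) :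
    heightCount F X = ((intBox n X).filter fun v => monicOfCoeffs v ∈ F).card := by
  have himg : {f | f ∈ F ∧ f.supNorm ≤ X} =
      monicOfCoeffs '' (((intBox n X).filter fun v => monicOfCoeffs v ∈ F : Finset (Fin n → ℤ)) :
        Set (Fin n → ℤ)) := by
    ext f
    simp only [Set.mem_image, Finset.coe_filter, Set.mem_ofPred_eq]
    constructor
    · rintro ⟨hf, hfX⟩
      have h := monicOfCoeffs_coeff (hF f hf).1 (hF f hf).2
      exact ⟨_, ⟨(supNorm_monicOfCoeffs_le_iff hX _).1 (by rwa [h]), by rwa [h]⟩, h⟩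
    · rintro ⟨v, ⟨hv, hvF⟩, rfl⟩
      exact ⟨hvF, (supNorm_monicOfCoeffs_le_iff hX v).2 hv⟩
  have hinj : Function.Injective (monicOfCoeffs : (Fin n → ℤ) → ℤ[X]) := fun u v h => by
    ext i
    rw [← coeff_monicOfCoeffs u i, h, coeff_monicOfCoeffs]
  rw [heightCount, himg, Set.ncard_image_of_injective _ hinj, Set.ncard_coe_finset]

theorem mem_eisensteinFamily_monicOfCoeffs_iff {p n : ℕ} (hp : p.Prime) (hn : 0 < n)
    (v : Fin n → ℤ) :
    monicOfCoeffs v ∈ EisensteinFamily p n ↔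
      (∀ j, (p : ℤ) ∣ v j) ∧ ¬ (p : ℤ) ^ 2 ∣ v ⟨0, hn⟩ := by
  have h0 := coeff_monicOfCoeffs v ⟨0, hn⟩
  constructor
  · rintro ⟨-, -, hE⟩
    refine ⟨fun j => ?_, fun h => hE.notMem ?_⟩
    · rw [← coeff_monicOfCoeffs v j, ← Ideal.mem_span_singleton]
      exact hE.mem (by rw [natDegree_monicOfCoeffs]; exact j.2)
    · rw [Ideal.span_singleton_pow, Ideal.mem_span_singleton]
      exact h0 ▸ h
  · rintro ⟨h1, h2⟩
    have hpu : ¬ IsUnit (p : ℤ) := (Nat.prime_iff_prime_int.1 hp).not_isUnit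
    refine ⟨monic_monicOfCoeffs v, natDegree_monicOfCoeffs v, ?_, fun {i} hi => ?_, ?_⟩
    · rw [(monic_monicOfCoeffs v).leadingCoeff, Ideal.mem_span_singleton]
      exact fun h => hpu (isUnit_of_dvd_one h)
    · rw [natDegree_monicOfCoeffs] at hi
      rw [coeff_monicOfCoeffs v ⟨i, hi⟩, Ideal.mem_span_singleton]
      exact h1 _
    · rw [Ideal.span_singleton_pow, Ideal.mem_span_singleton]
      exact fun h => h2 (h0 ▸ h)

theorem aeval_monicOfCoeffs {n : ℕ} {R : Type*} [CommRing R] (v : Fin n → ℤ) (x : R) :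
    aeval x (monicOfCoeffs v) = (monicOfCoeffs fun j => (v j : R)).eval x := by
  rw [aeval_def, ← eval_map, map_monicOfCoeffs]
  rfl

open Classical in
/-- The coefficient vectors modulo `q * r` of the monic polynomials without roots modulo `q` and
modulo `r`. -/
noncomputable def noRootVectors (n q r : ℕ) [NeZero (q * r)] : Finset (Fin n → ZMod (q * r)) :=
  {w | (∀ x : ZMod q, (monicOfCoeffs fun j => ((w j).cast : ZMod q)).eval x ≠ 0) ∧
    ∀ x : ZMod r, (monicOfCoeffs fun j => ((w j).cast : ZMod r)).eval x ≠ 0}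

theorem mem_noRootVectors {n q r : ℕ} [NeZero (q * r)] {w : Fin n → ZMod (q * r)} :
    w ∈ noRootVectors n q r ↔
      (∀ x : ZMod q, (monicOfCoeffs fun j => ((w j).cast : ZMod q)).eval x ≠ 0) ∧
        ∀ x : ZMod r, (monicOfCoeffs fun j => ((w j).cast : ZMod r)).eval x ≠ 0 := by
  simp [noRootVectors]

theorem card_noRootVectors {n q r : ℕ} [NeZero (q * r)] (hn : 2 ≤ n) (hq : q.Prime)
    (hr : r.Prime) (hqr : q.Coprime r) : (q * r) ^ n ≤ 36 * (noRootVectors n q r).card := by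
  classical
  have : Fact q.Prime := ⟨hq⟩
  have : Fact r.Prime := ⟨hr⟩
  set A := (Finset.univ.filter fun v : Fin n → ZMod q => ∀ x, (monicOfCoeffs v).eval x ≠ 0)
  set B := (Finset.univ.filter fun v : Fin n → ZMod r => ∀ x, (monicOfCoeffs v).eval x ≠ 0)
  have hA : q ^ n ≤ 6 * A.card := by
    simpa using card_pow_le_six_mul_card_no_root (F := ZMod q) hn
  have hB : r ^ n ≤ 6 * B.card := by
    simpa using card_pow_le_six_mul_card_no_root (F := ZMod r) hn
  have hAB : (A ×ˢ B).card ≤ (noRootVectors n q r).card := by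
    let e := ZMod.chineseRemainder hqr
    have he : ∀ t, ((e.symm t).cast : ZMod q) = t.1 ∧ ((e.symm t).cast : ZMod r) = t.2 := by
      intro t
      have h : e (e.symm t) = t := e.apply_symm_apply t
      exact ⟨(Prod.fst_zmod_cast _).symm.trans (congrArg Prod.fst h),
        (Prod.snd_zmod_cast _).symm.trans (congrArg Prod.snd h)⟩
    refine Finset.card_le_card_of_injOn (fun u j => e.symm (u.1 j, u.2 j)) ?_ ?_
    · rintro ⟨u, v⟩ huv
      obtain ⟨hu, hv⟩ := Finset.mem_product.1 (Finset.mem_coe.1 huv)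
      refine Finset.mem_coe.2 (mem_noRootVectors.2 ⟨?_, ?_⟩)
      · simpa only [he] using (Finset.mem_filter.1 hu).2
      · simpa only [he] using (Finset.mem_filter.1 hv).2
    · rintro ⟨u, v⟩ - ⟨u', v'⟩ - h
      have h' : ∀ j, (u j, v j) = (u' j, v' j) := fun j => e.symm.injective (congrFun h j)
      simp only [Prod.mk.injEq] at h'
      exact Prod.ext (funext fun j => (h' j).1) (funext fun j => (h' j).2)
  rw [Finset.card_product] at hAB
  calc (q * r) ^ n = q ^ n * r ^ n := mul_pow _ _ _
    _ ≤ (6 * A.card) * (6 * B.card) := Nat.mul_le_mul hA hB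
    _ = 36 * (A.card * B.card) := by ring
    _ ≤ _ := Nat.mul_le_mul_left _ hAB

open Classical in
/-- The coefficient vectors modulo `p ^ 2` of the Eisenstein polynomials. -/
noncomputable def eisensteinVectors (n p : ℕ) [NeZero (p ^ 2)] (hn : 0 < n) :
    Finset (Fin n → ZMod (p ^ 2)) :=
  {w | (∀ j, (p : ZMod (p ^ 2)) ∣ w j) ∧ w ⟨0, hn⟩ ≠ 0}

theorem eisensteinVectors_nonempty {n p : ℕ} [NeZero (p ^ 2)] (hn : 0 < n) (hp : p.Prime) :
    (eisensteinVectors n p hn).Nonempty := by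
  refine ⟨fun _ => p, Finset.mem_filter.2 ⟨Finset.mem_univ _, fun _ => dvd_rfl, ?_⟩⟩
  rw [Ne, ZMod.natCast_eq_zero_iff]
  intro h
  have := Nat.le_of_dvd hp.pos h
  nlinarith [hp.two_le]

/-- Being Eisenstein at `p` depends only on the coefficients modulo `p ^ 2`, so the family itself is
a residue condition. -/
theorem intCast_mem_eisensteinVectors_iff {n p : ℕ} [NeZero (p ^ 2)] (hn : 0 < n) (hp : p.Prime)
    (v : Fin n → ℤ) :
    (fun j => (v j : ZMod (p ^ 2))) ∈ eisensteinVectors n p hn ↔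
      monicOfCoeffs v ∈ EisensteinFamily p n := by
  rw [mem_eisensteinFamily_monicOfCoeffs_iff hp hn, eisensteinVectors, Finset.mem_filter]
  simp only [Finset.mem_univ, true_and]
  refine and_congr (forall_congr' fun j => ?_) (not_congr ?_)
  · constructor
    · rintro ⟨c, hc⟩
      have h : ((v j : ℤ) : ZMod (p ^ 2)) = ((p * (c.val : ℤ) : ℤ) : ZMod (p ^ 2)) := by
        rw [hc]; simp
      rw [ZMod.intCast_eq_intCast_iff] at h
      have h2 := h.dvd
      push_cast at h2
      have h3 := (dvd_pow_self (p : ℤ) two_ne_zero).trans h2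
      exact (dvd_sub_right (dvd_mul_right _ _)).1 h3
    · rintro ⟨c, hc⟩
      exact ⟨c, by rw [hc]; simp⟩
  · rw [ZMod.intCast_zmod_eq_zero_iff_dvd]
    push_cast
    rfl

/-! ### Independence of the tests and the lower density -/

section Density

variable {κ : Type*} [Fintype κ] {n : ℕ} {m : Option κ → ℕ}

/-- Independent conditions, each of probability at least `1 / 36`, are all violated with small
probability. -/
theorem one_sub_pow_le_liminf_heilbronnProportion {p : ℕ} (hm : ∀ i, 0 < m i)
    (hcop : Pairwise (Nat.Coprime.onFun m)) (E : Finset (Fin n → ZMod (m none)))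
    (hE : E.Nonempty) (G : ∀ i : κ, Finset (Fin n → ZMod (m (some i))))
    (hG : ∀ i, m (some i) ^ n ≤ 36 * (G i).card)
    (hEv : ∀ v : Fin n → ℤ, residues m v none ∈ E ↔ monicOfCoeffs v ∈ EisensteinFamily p n)
    (hGv : ∀ v : Fin n → ℤ, monicOfCoeffs v ∈ EisensteinFamily p n →
      ∀ i, residues m v (some i) ∈ G i → HeilbronnApplies (monicOfCoeffs v)) :
    1 - (35 / 36 : ℝ) ^ Fintype.card κ ≤ liminf (heilbronnProportion p n) atTop := by
  classical
  have : ∀ i, NeZero (m i) := fun i => ⟨(hm i).ne'⟩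
  -- The index `none` carries the Eisenstein condition and `some i` the `i`-th test: `A` leaves the
  -- tests free, `B` makes all of them fail.
  let A : ∀ o, Finset (Fin n → ZMod (m o)) := fun o => Option.rec E (fun i => Finset.univ) o
  let B : ∀ o, Finset (Fin n → ZMod (m o)) := fun o => Option.rec E (fun i => (G i)ᶜ) o
  let T := Fintype.piFinset A
  let U := Fintype.piFinset B
  have hUT : U ⊆ T := Fintype.piFinset_subset _ _ fun o => by
    cases o
    · exact subset_rfl
    · exact Finset.subset_univ _
  have hTcard : (T.card : ℝ) = E.card * ∏ i, (m (some i) : ℝ) ^ n := by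
    simp only [T, Fintype.card_piFinset, Fintype.prod_option, A]
    simp
  have hUcard : (U.card : ℝ) = E.card * ∏ i, ((G i)ᶜ.card : ℝ) := by
    simp only [U, Fintype.card_piFinset, Fintype.prod_option, B]
    simp
  have hGc : ∀ i, ((G i)ᶜ.card : ℝ) ≤ 35 / 36 * (m (some i) : ℝ) ^ n := by
    intro i
    have h1 : (m (some i) : ℝ) ^ n ≤ 36 * (G i).card := by exact_mod_cast hG i
    have h2 : ((G i).card : ℝ) + (G i)ᶜ.card = (m (some i) : ℝ) ^ n := by
      have := (G i).card_add_card_compl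
      rw [Fintype.card_fun, ZMod.card, Fintype.card_fin] at this
      exact_mod_cast this
    linarith
  have hUT' : (U.card : ℝ) ≤ (35 / 36) ^ Fintype.card κ * T.card := by
    rw [hTcard, hUcard]
    calc (E.card : ℝ) * ∏ i, ((G i)ᶜ.card : ℝ)
        ≤ E.card * ∏ i, (35 / 36 * (m (some i) : ℝ) ^ n) := by
          gcongr with i
          exact hGc i
      _ = _ := by rw [Finset.prod_mul_distrib, Finset.prod_const, Finset.card_univ]; ring
  have hT : T.Nonempty := Fintype.piFinset_nonempty.2 fun o => by
    cases o
    · exact hE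
    · exact Finset.univ_nonempty
  have hT0 : (0 : ℝ) < T.card := Nat.cast_pos.2 hT.card_pos
  have hmemT : ∀ v : Fin n → ℤ, residues m v ∈ T ↔ monicOfCoeffs v ∈ EisensteinFamily p n := by
    intro v
    rw [← hEv, Fintype.mem_piFinset]
    refine ⟨fun h => h none, fun h o => ?_⟩
    cases o
    · exact h
    · exact Finset.mem_univ _
  have hmemS : ∀ v : Fin n → ℤ, residues m v ∈ T \ U → HeilbronnApplies (monicOfCoeffs v) := by
    intro v hv
    obtain ⟨hvT, hvU⟩ := Finset.mem_sdiff.1 hv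
    rw [Fintype.mem_piFinset, not_forall] at hvU
    obtain ⟨o, ho⟩ := hvU
    cases o with
    | none => exact absurd ((hEv v).2 ((hmemT v).1 hvT)) ho
    | some i => exact hGv v ((hmemT v).1 hvT) i (by simpa [B] using ho)
  have hlim := tendsto_card_filter_residues_div hm hcop (T \ U) T hT
  have hle : 1 - (35 / 36 : ℝ) ^ Fintype.card κ ≤ ((T \ U).card : ℝ) / T.card := by
    rw [le_div_iff₀ hT0, Finset.card_sdiff_of_subset hUT,
      Nat.cast_sub (Finset.card_le_card hUT)]
    linarith
  -- In `ℝ`, comparing the lower limits requires the proportion to be bounded above eventually.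
  have hbdd : ∀ X, heilbronnProportion p n X ≤ 1 ∨ X < 1 := by
    intro X
    by_cases hX : X < 1
    · exact Or.inr hX
    · left
      refine div_le_one_of_le₀ (Nat.cast_le.2 ?_) (Nat.cast_nonneg _)
      rw [heightCount_eq_card (n := n) (fun f hf => ⟨hf.1.1, hf.1.2.1⟩) (not_lt.1 hX),
        heightCount_eq_card (n := n) (fun f hf => ⟨hf.1, hf.2.1⟩) (not_lt.1 hX)]
      refine Finset.card_le_card fun v hv => ?_
      rw [Finset.mem_filter] at hv ⊢
      exact ⟨hv.1, hv.2.1⟩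
  refine hle.trans (hlim.liminf_eq ▸ liminf_le_liminf ?_ hlim.isBoundedUnder_ge ?_)
  · filter_upwards [eventually_ge_atTop 1] with X hX
    rw [heilbronnProportion, heightCount_eq_card (n := n) (fun f hf => ⟨hf.1.1, hf.1.2.1⟩) hX,
      heightCount_eq_card (n := n) (fun f hf => ⟨hf.1, hf.2.1⟩) hX]
    have h1 : ((intBox n X).filter fun v => residues m v ∈ T) =
        (intBox n X).filter fun v => monicOfCoeffs v ∈ EisensteinFamily p n :=
      Finset.filter_congr fun v _ => hmemT v
    rw [h1]
    refine div_le_div_of_nonneg_right (Nat.cast_le.2 (Finset.card_le_card fun v hv => ?_))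
      (Nat.cast_nonneg _)
    rw [Finset.mem_filter] at hv ⊢
    exact ⟨hv.1, (hmemT v).1 (Finset.mem_sdiff.1 hv.2).1, hmemS v hv.2⟩
  · refine IsBoundedUnder.isCoboundedUnder_ge ⟨1, ?_⟩
    rw [eventually_map]
    filter_upwards [eventually_ge_atTop 1] with X hX
    exact (hbdd X).resolve_right (not_lt.2 hX)

end Density

/-- The moduli are `p ^ 2` and the products `q i * r i`. The case `K = 0` covers primes too small
for any test, where the bound is 0. -/
theorem one_sub_pow_le_liminf_of_two_pow_le {n p K : ℕ} (hn : 2 ≤ n) (hp : p.Prime)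
    (hgcd : (Nat.gcd (p - 1) n : ℝ) < (p : ℝ) ^ (1 / 2 : ℝ) / Real.log p ^ 2)
    (hK : K = 0 ∨ 2 ^ (10 * 4 ^ K) ≤ p) :
    1 - (35 / 36 : ℝ) ^ K ≤ liminf (heilbronnProportion p n) atTop := by
  have hA : powerResidues n p ⊆ Finset.Ioo 0 p := fun a ha =>
    Finset.mem_Ioo.2 (mem_powerResidues.1 ha).1
  obtain ⟨a, q, r, h1, h2⟩ := exists_coprime_isExactSplitting hA K fun k hk =>
    mul_powerfulBound_lt_card_powerResidues hp hgcd (hK.resolve_left (by omega)) hk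
  have hI : ∀ i < K, 0 < a i ∧ a i < p := fun i hi => Finset.mem_Ioo.1 (hA (h1 i hi).1)
  have hqr : ∀ i < K, (q i).Coprime (r i) := by
    intro i hi
    obtain ⟨-, hs⟩ := h1 i hi
    -- A common prime of `a` and `p - a` would divide `p`, hence equal it, although it is at most `a
    -- < p`.
    refine (Nat.coprime_primes hs.prime_left hs.prime_right).2 fun h => ?_
    have hqp : q i ∣ p := by
      have := Nat.dvd_add hs.dvd_left (h ▸ hs.dvd_right)
      rwa [Nat.add_sub_cancel' (hI i hi).2.le] at this
    have := (Nat.prime_dvd_prime_iff_eq hs.prime_left hp).1 hqp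
    have := Nat.le_of_dvd (hI i hi).1 hs.dvd_left
    have := (hI i hi).2
    omega
  have hpc : ∀ i < K, (p ^ 2).Coprime (q i * r i) := by
    intro i hi
    obtain ⟨-, hs⟩ := h1 i hi
    have h3 := Nat.le_of_dvd (hI i hi).1 hs.dvd_left
    have h4 := Nat.le_of_dvd (Nat.sub_pos_of_lt (hI i hi).2) hs.dvd_right
    have h5 := hI i hi
    exact Nat.Coprime.pow_left 2 (Nat.Coprime.mul_right
      ((Nat.coprime_primes hp hs.prime_left).2 (by omega))
      ((Nat.coprime_primes hp hs.prime_right).2 (by omega)))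
  let m : Option (Fin K) → ℕ := fun o => o.elim (p ^ 2) fun i => q i * r i
  have hm : ∀ o, 0 < m o := by
    rintro (_ | i)
    · exact pow_pos hp.pos 2
    · exact Nat.mul_pos (h1 i i.2).2.prime_left.pos (h1 i i.2).2.prime_right.pos
  have : NeZero (p ^ 2) := ⟨(hm none).ne'⟩
  have : ∀ i : Fin K, NeZero (q i * r i) := fun i => ⟨(hm (some i)).ne'⟩
  have hcop : Pairwise (Nat.Coprime.onFun m) := by
    rintro (_ | i) (_ | j) hij
    · exact absurd rfl hij
    · exact hpc j j.2
    · exact (hpc i i.2).symm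
    · rcases lt_trichotomy i j with h | h | h
      · exact (h2 j j.2 i h).symm
      · exact absurd (congrArg some h) hij
      · exact h2 i i.2 j h
  have key := one_sub_pow_le_liminf_heilbronnProportion (p := p) (n := n) hm hcop
    (eisensteinVectors n p (by omega)) (eisensteinVectors_nonempty _ hp)
    (fun i => noRootVectors n (q i) (r i))
    (fun i => card_noRootVectors hn (h1 i i.2).2.prime_left (h1 i i.2).2.prime_right (hqr i i.2))
    (fun v => intCast_mem_eisensteinVectors_iff _ hp v) ?_
  · rwa [Fintype.card_fin] at key
  · intro v hv i hi
    obtain ⟨ha, hs⟩ := h1 i i.2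
    obtain ⟨h3, h4⟩ := mem_noRootVectors.1 hi
    have h5 := hI i i.2
    refine heilbronnApplies_of_no_root (by omega) hp hv h5.1 (Nat.sub_pos_of_lt h5.2)
      (Nat.add_sub_cancel' h5.2.le).symm (mem_powerResidues.1 ha).2 hs.prime_left hs.dvd_left
      hs.not_sq_dvd_left hs.prime_right hs.dvd_right hs.not_sq_dvd_right ?_ ?_
    · intro x
      rw [aeval_monicOfCoeffs]
      have e : (fun j => ((residues m v (some i) j).cast : ZMod (q i))) =
          fun j => (v j : ZMod (q i)) := funext fun j => ZMod.cast_intCast (dvd_mul_right _ _) _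
      rw [← e]
      exact h3 x
    · intro x
      rw [aeval_monicOfCoeffs]
      have e : (fun j => ((residues m v (some i) j).cast : ZMod (r i))) =
          fun j => (v j : ZMod (r i)) := funext fun j => ZMod.cast_intCast (dvd_mul_left _ _) _
      rw [← e]
      exact h4 x

/-! ### Computability and effective convergence of the error term -/

theorem Primrec.nat_pow : Primrec₂ ((· ^ ·) : ℕ → ℕ → ℕ) := by
  refine Primrec₂.of_eq (f := fun a b => Nat.rec 1 (fun _ t => t * a) b) ?_ fun a b => ?_
  · exact Primrec.nat_rec' (f := fun x : ℕ × ℕ => x.2) (g := fun _ => 1)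
      (h := fun x t => t.2 * x.1) Primrec.snd (Primrec.const 1)
      (Primrec.nat_mul.comp (Primrec.snd.comp Primrec.snd) (Primrec.fst.comp Primrec.fst))
  · induction b with
    | zero => rfl
    | succ b ih => rw [pow_succ, ← ih]

/-- A lower bound for the primes at which `K` independent tests are available. -/
def splittingThreshold (K : ℕ) : ℕ := 2 ^ (10 * 4 ^ K)

theorem primrec_splittingThreshold : Primrec splittingThreshold :=
  Primrec.nat_pow.comp (Primrec.const 2)
    (Primrec.nat_mul.comp (Primrec.const 10) (Primrec.nat_pow.comp (Primrec.const 4) Primrec.id))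

/-- Ensures that the search up to `p` in `splittingCount` misses no admissible `K`. -/
theorem self_le_splittingThreshold (K : ℕ) : K ≤ splittingThreshold K := by
  have h1 : K < 4 ^ K := Nat.lt_pow_self (by norm_num)
  have h2 : 10 * 4 ^ K < 2 ^ (10 * 4 ^ K) := Nat.lt_two_pow_self
  rw [splittingThreshold]
  omega

/-- The number of independent tests available at `p`. -/
def splittingCount (p : ℕ) : ℕ := Nat.findGreatest (fun K => splittingThreshold K ≤ p) p

theorem primrec_splittingCount : Primrec splittingCount :=
  Primrec.nat_findGreatest Primrec.id
    (Primrec.nat_le.comp (primrec_splittingThreshold.comp Primrec.snd) Primrec.fst)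

theorem splittingCount_eq_zero_or (p : ℕ) :
    splittingCount p = 0 ∨ splittingThreshold (splittingCount p) ≤ p :=
  or_iff_not_imp_left.2 fun h =>
    Nat.findGreatest_of_ne_zero (P := fun K => splittingThreshold K ≤ p) rfl h

theorem le_splittingCount {K p : ℕ} (h : splittingThreshold K ≤ p) : K ≤ splittingCount p :=
  Nat.le_findGreatest ((self_le_splittingThreshold K).trans h) h

theorem isComputableRealSeq_div_pow {K : ℕ → ℕ} (hK : Primrec K) (a b : ℕ) :
    IsComputableRealSeq fun p => ((a : ℝ) / b) ^ K p := by
  -- Natural division rounds down, an error below one unit of `2 ^ (-k)`.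
  refine ⟨fun m k => 2 ^ k * a ^ K m / b ^ K m, fun _ _ => 0, ?_, ?_, fun m k => ?_⟩
  · have h1 : Primrec₂ fun m k : ℕ => 2 ^ k * a ^ K m / b ^ K m :=
      Primrec.nat_div.comp
        (Primrec.nat_mul.comp (Primrec.nat_pow.comp (Primrec.const 2) Primrec.snd)
          (Primrec.nat_pow.comp (Primrec.const a) (hK.comp Primrec.fst)))
        (Primrec.nat_pow.comp (Primrec.const b) (hK.comp Primrec.fst))
    exact h1.to_comp
  · exact Computable.const 0
  · have h2 : (0 : ℝ) < 2 ^ k := by positivity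
    have h3 : ((a : ℝ) / b) ^ K m = ((2 ^ k * a ^ K m : ℕ) : ℝ) / ((b ^ K m : ℕ) : ℝ) / 2 ^ k := by
      push_cast
      rw [div_pow]
      field_simp
    beta_reduce
    rw [h3, Nat.cast_zero, sub_zero, ← sub_div, abs_div, abs_of_pos h2]
    refine div_le_div_of_nonneg_right ?_ h2.le
    rw [← Nat.floor_div_eq_div (K := ℝ), abs_of_nonneg (sub_nonneg.2 (Nat.floor_le (by positivity)))]
    linarith [Nat.lt_floor_add_one
      (((2 ^ k * a ^ K m : ℕ) : ℝ) / ((b ^ K m : ℕ) : ℝ))]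

theorem TendsToZeroEffectively.tendsto {x : ℕ → ℝ} (hx : TendsToZeroEffectively x) :
    Tendsto x atTop (𝓝 0) := by
  obtain ⟨N, -, hN⟩ := hx
  rw [Metric.tendsto_atTop]
  intro δ hδ
  obtain ⟨k, hk⟩ := exists_pow_lt_of_lt_one hδ (by norm_num : (1 / 2 : ℝ) < 1)
  refine ⟨N k, fun m hm => ?_⟩
  rw [Real.dist_eq, sub_zero]
  refine (hN k m hm).trans_lt ?_
  rwa [one_div_pow] at hk

theorem tendsToZeroEffectively_pow_splittingCount :
    TendsToZeroEffectively fun p => (35 / 36 : ℝ) ^ splittingCount p := by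
  -- The exponent 25 is chosen so that `(35/36) ^ 25 ≤ 1/2`.
  refine ⟨fun k => splittingThreshold (25 * k), ?_, fun k m hm => ?_⟩
  · exact (primrec_splittingThreshold.comp
      (Primrec.nat_mul.comp (Primrec.const 25) Primrec.id)).to_comp
  · rw [abs_of_nonneg (by positivity)]
    calc (35 / 36 : ℝ) ^ splittingCount m ≤ (35 / 36) ^ (25 * k) :=
          pow_le_pow_of_le_one (by norm_num) (by norm_num) (le_splittingCount hm)
      _ = ((35 / 36) ^ 25) ^ k := pow_mul _ _ _
      _ ≤ (1 / 2) ^ k := by gcongr; norm_num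
      _ = 1 / 2 ^ k := one_div_pow _ _

theorem theorem2 :
    ∃ ε : ℕ → ℝ,
      IsComputableRealSeq ε ∧ Tendsto ε atTop (𝓝 0) ∧ TendsToZeroEffectively ε ∧
      ∀ n p : ℕ, 2 ≤ n → 5 ≤ p → p.Prime →
        (Nat.gcd (p - 1) n : ℝ) < (p : ℝ) ^ (1 / 2 : ℝ) / Real.log p ^ 2 →
        1 - ε p ≤ liminf (heilbronnProportion p n) atTop := by
  refine ⟨fun p => (35 / 36 : ℝ) ^ splittingCount p, ?_,
    tendsToZeroEffectively_pow_splittingCount.tendsto, tendsToZeroEffectively_pow_splittingCount,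
    fun n p hn _ hp hgcd =>
      one_sub_pow_le_liminf_of_two_pow_le hn hp hgcd (splittingCount_eq_zero_or p)⟩
  exact_mod_cast isComputableRealSeq_div_pow primrec_splittingCount 35 36
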